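/- Let $\mathcal{H}$ be a separable complex Hilbert space and let $C:\mathcal{H}\to\mathcal{H}$ be a conjugation, that is, an anti-linear map with $C^2=I$ and $\langle Cx,Cy\rangle=\langle y,x\rangle$ for all $x,y\in\mathcal{H}$. Let $T$ be a compact linear operator on $\mathcal{H}$ which is $C$-normal, that is, $C|T|C=|T^*|$, where $|X|=(X^*X)^{1/2}$. Let $T=A+iB$ be the Cartesian decomposition of $T$ with respect to $C$, that is, $A$ and $B$ are the (unique) bounded linear operators with $T=A+iB$ such that $A$ is $C$-symmetric ($A^*=CAC$) and $B$ is $C$-skew-symmetric ($CB^*C=-B$). For a compact operator $X$, let $s_1(X)\ge s_2(X)\ge\cdots$ denote its singular values, i.e. the eigenvalues of $|X|$ in decreasing order, repeated according to multiplicity (and continued by zeros if $X$ has finite rank). Then $BA^*$, $AB^*$ and the operator $(T^*T)\oplus(TT^*)$ on $\mathcal{H}\oplus\mathcal{H}$ are compact, and $$2\,s_j(BA^*)=2\,s_j(AB^*)\le s_j\big((T^*T)\oplus(TT^*)\big)\qquad\text{for all } j=1,2,\dots$$ -/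

import Mathlib

open ContinuousLinearMap

universe u

section

variable {H : Type u} [NormedAddCommGroup H] [InnerProductSpace ℂ H]

/-- A conjugation: an anti-linear isometric involution `C` of a complex inner product space. -/
structure IsConjugation (C : H → H) : Prop where
  antilinear : ∀ (α : ℂ) (x y : H), C (α • x + y) = starRingEnd ℂ α • C x + C y
  involutive : ∀ x : H, C (C x) = x
  inner_map_map : ∀ x y : H, inner ℂ (C x) (C y) = inner ℂ y x

variable [CompleteSpace H]

/-- `T` is `C`-normal: `C |T| C = |T*|`, where `|T| = (T* T)^{1/2}` is `CFC.abs T`. -/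
def IsCNormal (C : H → H) (T : H →L[ℂ] H) : Prop :=
  ∀ x : H, C (CFC.abs T (C x)) = CFC.abs (adjoint T) x

/-- `T` is `C`-symmetric: `T* = C T C`. -/
def IsCSymmetric (C : H → H) (T : H →L[ℂ] H) : Prop :=
  ∀ x : H, adjoint T x = C (T (C x))

/-- `T` is `C`-skew-symmetric: `C T* C = -T`. -/
def IsCSkewSymmetric (C : H → H) (T : H →L[ℂ] H) : Prop :=
  ∀ x : H, C (adjoint T (C x)) = -T x

/-- `T = A + i B` is the Cartesian decomposition of `T` with respect to the conjugation `C`: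
`A` is `C`-symmetric and `B` is `C`-skew-symmetric. (Such `A`, `B` exist and are unique:
`A = (T + C T* C) / 2` and `B = (T - C T* C) / (2 i)`.) -/
structure IsCartesianDecomposition (C : H → H) (T A B : H →L[ℂ] H) : Prop where
  eq_add : T = A + Complex.I • B
  symm : IsCSymmetric C A
  skew : IsCSkewSymmetric C B

/-- The number of eigenvalues of `|T|` in the interval `(t, ∞)`, each one counted as often as its
multiplicity (the dimension of its eigenspace). -/
noncomputable def eigenvalueCount (T : H →L[ℂ] H) (t : ℝ) : Cardinal.{u} :=
  Cardinal.sum fun μ : Set.Ioi t =>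
    Module.rank ℂ
      (Module.End.eigenspace ((CFC.abs T : H →L[ℂ] H) : H →ₗ[ℂ] H) ((μ : ℝ) : ℂ))

/-- For a compact operator `T` and `j = 1, 2, …`, the `j`-th singular value `s_j(T)`, that is, the
`j`-th term of the decreasing enumeration `s_1(T) ≥ s_2(T) ≥ …` of the eigenvalues of `|T|`,
repeated according to multiplicity (and continued by zeros if `T` has finite rank): it is the
smallest `t ≥ 0` such that fewer than `j` eigenvalues of `|T|`, counted with multiplicity,
exceed `t`. -/
noncomputable def singularValue (T : H →L[ℂ] H) (j : ℕ) : ℝ :=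
  sInf {t : ℝ | 0 ≤ t ∧ eigenvalueCount T t < (j : Cardinal.{u})}

/-- The direct sum `S ⊕ R` on the Hilbert space direct sum `H ⊕ H`, `(x, y) ↦ (S x, R y)`. -/
noncomputable def directSumOp (S R : H →L[ℂ] H) :
    WithLp 2 (H × H) →L[ℂ] WithLp 2 (H × H) :=
  ((WithLp.prodContinuousLinearEquiv 2 ℂ H H).symm : H × H →L[ℂ] WithLp 2 (H × H)) ∘L
    (S.prodMap R) ∘L
    ((WithLp.prodContinuousLinearEquiv 2 ℂ H H) : WithLp 2 (H × H) →L[ℂ] H × H)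

end

/-!
Write `T†` for the adjoint and put `T' = C T† C`. The symmetry of `A` and skew-symmetry of `B` give
`T' = A - i B`, and `C`-normality squares to `C T† T C = T T†`, which says `T' T'† = T T†`. Expanding
both sides in `A` and `B`, the cross terms must vanish: `B A† = A B†`
(`IsCartesianDecomposition.comp_adjoint_comm`). So `K = A B†` is self-adjoint, the first equality of
singular values is trivial, and `T T† = A A† + B B†`.

From `0 ≤ (A ± B) (A ± B)† = T T† ± 2 K` one gets `-T T† ≤ 2 K ≤ T T†`. By Weyl's comparison
(`sum_rank_eigenspace_le`), each of `2 K` and `-2 K` has at most as many eigenvalues above a given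
`t ≥ 0` as `T T†`. The eigenvalues of `|2 K|` come from those of `2 K` and `-2 K`
(`rank_eigenspace_abs_le`), while `T† T` and `T T†` have the same nonzero eigenvalues, so that
`T† T ⊕ T T†` carries those of `T T†` twice (`rank_eigenspace_add_self_le`). This bounds the singular
values (`two_mul_singularValue_le`).

Compactness of `B A†` follows from `‖A† x‖ ^ 2 ≤ ⟪T T† x, x⟫ ≤ ‖T T† x‖ ‖x‖`, which makes `A†`
compact (`isCompactOperator_of_norm_sq_le`).
-/

/-! ### Eigenvalue counts and quadratic forms -/

lemma sum_rank_eigenspace {V : Type u} [AddCommGroup V] [Module ℂ V] (f : Module.End ℂ V)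
    (s : Set ℝ) :
    Cardinal.sum (fun μ : s => Module.rank ℂ (f.eigenspace ((μ : ℝ) : ℂ))) =
      Module.rank ℂ ↥(⨆ μ : s, f.eigenspace ((μ : ℝ) : ℂ)) := by
  classical
  have hinj : Function.Injective fun μ : s => ((μ : ℝ) : ℂ) :=
    Complex.ofReal_injective.comp Subtype.val_injective
  have hind : iSupIndep fun μ : s => f.eigenspace ((μ : ℝ) : ℂ) :=
    f.eigenspaces_iSupIndep.comp hinj
  rw [Submodule.iSup_eq_range_dfinsupp_lsum,
    ← (LinearEquiv.ofInjective _ hind.dfinsupp_lsum_injective).rank_eq]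
  refine Eq.trans ?_ (rank_directSum (R := ℂ) fun μ : s => f.eigenspace ((μ : ℝ) : ℂ)).symm
  rfl

section QuadraticForm

variable {E : Type u} [NormedAddCommGroup E] [InnerProductSpace ℂ E]

/-- A vector in the span of eigenspaces is a finite sum of orthogonal eigenvectors, which
diagonalizes the norm and the quadratic form. -/
lemma exists_sum_of_mem_iSup_eigenspace {K : E →L[ℂ] E} (hK : (K : E →ₗ[ℂ] E).IsSymmetric)
    {s : Set ℝ} {x : E}
    (hx : x ∈ ⨆ μ : s, Module.End.eigenspace (K : E →ₗ[ℂ] E) ((μ : ℝ) : ℂ)) :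
    ∃ (F : Finset s) (l : s → E), x = ∑ i ∈ F, l i ∧ ‖x‖ ^ 2 = ∑ i ∈ F, ‖l i‖ ^ 2 ∧
      (inner ℂ (K x) x).re = ∑ i ∈ F, (i : ℝ) * ‖l i‖ ^ 2 := by
  classical
  have hinj : Function.Injective fun μ : s => ((μ : ℝ) : ℂ) :=
    Complex.ofReal_injective.comp Subtype.val_injective
  have hV := hK.orthogonalFamily_eigenspaces.comp hinj
  rw [Submodule.mem_iSup_iff_exists_dfinsupp'] at hx
  obtain ⟨l, rfl⟩ := hx
  have hl : ∀ i, K (l i : E) = ((i : ℝ) : ℂ) • (l i : E) := fun i =>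
    Module.End.mem_eigenspace_iff.mp (l i).2
  refine ⟨l.support, fun i => l i, rfl, ?_, ?_⟩
  · exact hV.norm_sum (fun i => l i) l.support
  · have h1 : K (l.sum fun _ y => (y : E)) =
        ∑ i ∈ l.support, (((((i : ℝ) : ℂ) • l i : _) :
          Module.End.eigenspace (K : E →ₗ[ℂ] E) ((i : ℝ) : ℂ)) : E) := by
      simp [DFinsupp.sum, map_sum, hl]
    rw [h1]
    refine (congrArg Complex.re
      (hV.inner_sum (fun i => ((i : ℝ) : ℂ) • l i) (fun i => l i) l.support)).trans ?_
    rw [Complex.re_sum]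
    refine Finset.sum_congr rfl fun i _ => ?_
    rw [inner_smul_left, inner_self_eq_norm_sq_to_K, Complex.conj_ofReal, Complex.re_ofReal_mul]
    norm_cast

lemma lt_re_inner_of_mem_iSup_eigenspace {K : E →L[ℂ] E}
    (hK : (K : E →ₗ[ℂ] E).IsSymmetric) {t : ℝ} {x : E}
    (hx : x ∈ ⨆ μ : Set.Ioi t, Module.End.eigenspace (K : E →ₗ[ℂ] E) ((μ : ℝ) : ℂ))
    (hx0 : x ≠ 0) : t * ‖x‖ ^ 2 < (inner ℂ (K x) x).re := by
  obtain ⟨F, l, rfl, hn, hq⟩ := exists_sum_of_mem_iSup_eigenspace hK hx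
  rw [hn, hq, Finset.mul_sum]
  obtain ⟨i, hi, hi0⟩ := Finset.exists_ne_zero_of_sum_ne_zero hx0
  refine Finset.sum_lt_sum (fun i _ => ?_) ⟨i, hi, ?_⟩
  · exact mul_le_mul_of_nonneg_right (le_of_lt i.2) (sq_nonneg _)
  · exact mul_lt_mul_of_pos_right i.2 (by positivity)

lemma re_inner_le_of_mem_iSup_eigenspace {K : E →L[ℂ] E}
    (hK : (K : E →ₗ[ℂ] E).IsSymmetric) {t : ℝ} {x : E}
    (hx : x ∈ ⨆ μ : Set.Iic t, Module.End.eigenspace (K : E →ₗ[ℂ] E) ((μ : ℝ) : ℂ)) :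
    (inner ℂ (K x) x).re ≤ t * ‖x‖ ^ 2 := by
  obtain ⟨F, l, rfl, hn, hq⟩ := exists_sum_of_mem_iSup_eigenspace hK hx
  rw [hn, hq, Finset.mul_sum]
  exact Finset.sum_le_sum fun i _ => mul_le_mul_of_nonneg_right i.2 (sq_nonneg _)

variable [CompleteSpace E]

/-- By the spectral theorem, the orthogonal complement of the eigenspaces above `t` is the closed
span of those at or below `t`. -/
lemma re_inner_le_of_mem_orthogonal {P : E →L[ℂ] E} (hP : (P : E →ₗ[ℂ] E).IsSymmetric)
    (hPc : IsCompactOperator P) {t : ℝ} {x : E}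
    (hx : x ∈ (⨆ μ : Set.Ioi t,
      Module.End.eigenspace (P : E →ₗ[ℂ] E) ((μ : ℝ) : ℂ))ᗮ) :
    (inner ℂ (P x) x).re ≤ t * ‖x‖ ^ 2 := by
  set W := ⨆ μ : Set.Ioi t, Module.End.eigenspace (P : E →ₗ[ℂ] E) ((μ : ℝ) : ℂ) with hW
  set U₀ := ⨆ μ : Set.Iic t, Module.End.eigenspace (P : E →ₗ[ℂ] E) ((μ : ℝ) : ℂ) with hU₀
  set U := U₀.topologicalClosure with hU
  have : CompleteSpace U := (Submodule.isClosed_topologicalClosure U₀).completeSpace_coe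
  have hUW : U ≤ Wᗮ := by
    refine Submodule.topologicalClosure_minimal _ ?_ (Submodule.isClosed_orthogonal W)
    rw [hU₀, hW, ← Submodule.iInf_orthogonal, iSup_le_iff]
    intro μ
    rw [le_iInf_iff]
    intro ν
    refine Submodule.isOrtho_iff_le.mp (hP.orthogonalFamily_eigenspaces.isOrtho ?_)
    have : (μ : ℝ) < ν := lt_of_le_of_lt μ.2 ν.2
    exact_mod_cast this.ne
  obtain ⟨p, hp, q, hq, rfl⟩ := U.exists_add_mem_mem_orthogonal x
  have hqW : q ∈ Wᗮ := by simpa using Wᗮ.sub_mem hx (hUW hp)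
  have hq0 : q ∈ (⨆ μ : ℂ, Module.End.eigenspace (P : E →ₗ[ℂ] E) μ)ᗮ := by
    rw [← Submodule.iInf_orthogonal, Submodule.mem_iInf]
    intro μ
    by_cases h : Module.End.HasEigenvalue (P : E →ₗ[ℂ] E) μ
    · obtain ⟨r, rfl⟩ := Complex.conj_eq_iff_real.mp (hP.conj_eigenvalue_eq_self h)
      rcases lt_or_ge t r with hr | hr
      · exact Submodule.orthogonal_le (le_iSup (fun μ : Set.Ioi t =>
          Module.End.eigenspace (P : E →ₗ[ℂ] E) ((μ : ℝ) : ℂ)) ⟨r, hr⟩) hqW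
      · exact Submodule.orthogonal_le ((le_iSup (fun μ : Set.Iic t =>
          Module.End.eigenspace (P : E →ₗ[ℂ] E) ((μ : ℝ) : ℂ)) ⟨r, hr⟩).trans
          U₀.le_topologicalClosure) hq
    · rw [Module.End.hasEigenvalue_iff, not_not] at h
      rw [h]
      simp
  rw [orthogonalComplement_iSup_eigenspaces_eq_bot hPc hP, Submodule.mem_bot] at hq0
  rw [hq0, add_zero]
  -- The bound holds on the algebraic span and passes to its closure.
  have hclosed : IsClosed {y : E | (inner ℂ (P y) y).re ≤ t * ‖y‖ ^ 2} :=
    isClosed_le (by fun_prop) (by fun_prop)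
  exact closure_minimal (fun y hy => re_inner_le_of_mem_iSup_eigenspace hP hy) hclosed hp

/-- Weyl's comparison: a subspace on which the form of `P` exceeds `t` meets the orthogonal
complement of the eigenspaces of `P` above `t` trivially, so it is at most as large as their span.
The finiteness hypothesis makes that span closed, which the projection onto it needs. -/
lemma sum_rank_eigenspace_le {K P : E →L[ℂ] E} (hK : (K : E →ₗ[ℂ] E).IsSymmetric)
    (hP : (P : E →ₗ[ℂ] E).IsSymmetric) (hPc : IsCompactOperator P) {s t : ℝ}
    (h : ∀ x : E, s * ‖x‖ ^ 2 < (inner ℂ (K x) x).re → t * ‖x‖ ^ 2 < (inner ℂ (P x) x).re)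
    (hfin : Cardinal.sum (fun μ : Set.Ioi t =>
      Module.rank ℂ (Module.End.eigenspace (P : E →ₗ[ℂ] E) ((μ : ℝ) : ℂ))) < Cardinal.aleph0) :
    Cardinal.sum (fun μ : Set.Ioi s =>
      Module.rank ℂ (Module.End.eigenspace (K : E →ₗ[ℂ] E) ((μ : ℝ) : ℂ))) ≤
    Cardinal.sum (fun μ : Set.Ioi t =>
      Module.rank ℂ (Module.End.eigenspace (P : E →ₗ[ℂ] E) ((μ : ℝ) : ℂ))) := by
  rw [sum_rank_eigenspace] at hfin
  rw [sum_rank_eigenspace, sum_rank_eigenspace]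
  set V := ⨆ μ : Set.Ioi s, Module.End.eigenspace (K : E →ₗ[ℂ] E) ((μ : ℝ) : ℂ)
  set W := ⨆ μ : Set.Ioi t, Module.End.eigenspace (P : E →ₗ[ℂ] E) ((μ : ℝ) : ℂ) with hW
  have : FiniteDimensional ℂ W := Module.rank_lt_aleph0_iff.mp hfin
  refine LinearMap.rank_le_of_injective
    ((W.orthogonalProjectionOnto : E →ₗ[ℂ] W) ∘ₗ V.subtype) ?_
  rw [injective_iff_map_eq_zero]
  intro x hx
  by_contra hx0
  have hxW : (x : E) ∈ Wᗮ := Submodule.orthogonalProjectionOnto_eq_zero_iff.mp hx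
  have h1 := h x (lt_re_inner_of_mem_iSup_eigenspace hK x.2 (by simpa using hx0))
  exact absurd (re_inner_le_of_mem_orthogonal hP hPc hxW) (not_le.mpr h1)

/-- `x ↦ (|K| x + K x, |K| x - K x)` embeds an eigenspace of `|K|`. -/
lemma rank_eigenspace_abs_le {K : E →L[ℂ] E} (hK : IsSelfAdjoint K) {μ : ℝ} (hμ : μ ≠ 0) :
    Module.rank ℂ (Module.End.eigenspace ((CFC.abs K : E →L[ℂ] E) : E →ₗ[ℂ] E) (μ : ℂ)) ≤
      Module.rank ℂ (Module.End.eigenspace (K : E →ₗ[ℂ] E) (μ : ℂ)) +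
      Module.rank ℂ (Module.End.eigenspace ((-K : E →L[ℂ] E) : E →ₗ[ℂ] E) (μ : ℂ)) := by
  have hsq : ∀ x ∈ Module.End.eigenspace ((CFC.abs K : E →L[ℂ] E) : E →ₗ[ℂ] E) (μ : ℂ),
      K (K x) = (μ : ℂ) • (μ : ℂ) • x := by
    intro x hx
    have hx' : CFC.abs K x = (μ : ℂ) • x := Module.End.mem_eigenspace_iff.mp hx
    have h := congrArg (fun L : E →L[ℂ] E => L x) (CFC.abs_mul_abs K)
    simpa [hK.star_eq, hx'] using h.symm
  rw [← rank_prod']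
  refine LinearMap.rank_le_of_injective (LinearMap.prod
    (LinearMap.codRestrict _ (((μ : ℂ) • LinearMap.id + (K : E →ₗ[ℂ] E)) ∘ₗ
      Submodule.subtype _) ?_)
    (LinearMap.codRestrict _ (((μ : ℂ) • LinearMap.id - (K : E →ₗ[ℂ] E)) ∘ₗ
      Submodule.subtype _) ?_)) ?_
  · intro x
    rw [Module.End.mem_eigenspace_iff]
    simp [hsq x x.2, add_comm]
  · intro x
    rw [Module.End.mem_eigenspace_iff]
    simp [hsq x x.2, smul_sub]
  · rw [injective_iff_map_eq_zero]
    intro x hx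
    have h1 : (μ : ℂ) • (x : E) + K x = 0 := congrArg (fun p => (p.1 : E)) hx
    have h2 : (μ : ℂ) • (x : E) - K x = 0 := congrArg (fun p => (p.2 : E)) hx
    have h3 : (μ : ℂ) • (x : E) + (μ : ℂ) • (x : E) = 0 := by
      have := congrArg₂ (· + ·) h1 h2
      simpa using this
    rw [← two_smul ℂ, smul_smul] at h3
    have : (2 * (μ : ℂ)) ≠ 0 := by simpa using hμ
    exact Subtype.ext ((smul_eq_zero.mp h3).resolve_left this)

lemma eigenvalueCount_of_isPositive {S : E →L[ℂ] E} (hS : S.IsPositive) (t : ℝ) :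
    eigenvalueCount S t = Cardinal.sum (fun μ : Set.Ioi t =>
      Module.rank ℂ (Module.End.eigenspace (S : E →ₗ[ℂ] E) ((μ : ℝ) : ℂ))) := by
  rw [eigenvalueCount, CFC.abs_of_nonneg S ((nonneg_iff_isPositive S).mpr hS)]

/-- The set whose infimum defines a singular value is thus nonempty. -/
lemma exists_eigenvalueCount_eq_zero (S : E →L[ℂ] E) :
    ∃ t : ℝ, 0 ≤ t ∧ eigenvalueCount S t = 0 := by
  refine ⟨‖CFC.abs S‖, norm_nonneg _, ?_⟩
  rw [eigenvalueCount, sum_rank_eigenspace, rank_zero_iff, Submodule.subsingleton_iff_eq_bot,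
    iSup_eq_bot]
  intro μ
  rw [Submodule.eq_bot_iff]
  intro x hx
  have hx' : CFC.abs S x = ((μ : ℝ) : ℂ) • x := Module.End.mem_eigenspace_iff.mp hx
  have hμ : ‖CFC.abs S‖ < μ := μ.2
  have hμ0 : 0 ≤ (μ : ℝ) := (norm_nonneg _).trans hμ.le
  have h1 := (CFC.abs S).le_opNorm x
  rw [hx', norm_smul, Complex.norm_real, Real.norm_of_nonneg hμ0] at h1
  by_contra hx0
  have h2 : 0 < ‖x‖ := norm_pos_iff.mpr hx0
  exact absurd (le_of_mul_le_mul_right h1 h2) (not_le.mpr hμ)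

/-- The bound transfers total boundedness of the image of the unit ball from `G` to `F`. For
`G = T T†` it transfers compactness to `T†`, without Schauder's theorem. -/
lemma isCompactOperator_of_norm_sq_le {F G : E →L[ℂ] E} (hG : IsCompactOperator G)
    (h : ∀ x, ‖F x‖ ^ 2 ≤ ‖G x‖ * ‖x‖) : IsCompactOperator F := by
  have hGb : TotallyBounded (G '' Metric.ball 0 1) :=
    (hG.isCompact_closure_image_ball (f := (G : E →ₗ[ℂ] E)) 1).totallyBounded.subset subset_closure
  have hFb : TotallyBounded (F '' Metric.ball 0 1) := by
    rw [Metric.totallyBounded_iff]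
    intro ε hε
    obtain ⟨v, hv, hvfin, hcov⟩ := Set.exists_subset_image_finite_and.mp
      (Metric.finite_approx_of_totallyBounded hGb (ε ^ 2 / 2) (by positivity))
    refine ⟨F '' v, hvfin.image F, ?_⟩
    rintro _ ⟨x, hx, rfl⟩
    have hGx := hcov (Set.mem_image_of_mem G hx)
    simp only [Set.biUnion_image, Set.mem_iUnion, Metric.mem_ball] at hGx ⊢
    obtain ⟨y, hy, hxy⟩ := hGx
    refine ⟨y, hy, ?_⟩
    have hy1 := hv hy
    rw [mem_ball_zero_iff] at hx hy1
    rw [dist_eq_norm, ← map_sub] at hxy ⊢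
    have h2 : ‖x - y‖ ≤ 2 := (norm_sub_le x y).trans (by linarith)
    refine lt_of_pow_lt_pow_left₀ 2 hε.le ?_
    calc ‖F (x - y)‖ ^ 2 ≤ ‖G (x - y)‖ * ‖x - y‖ := h _
      _ ≤ ‖G (x - y)‖ * 2 := by gcongr
      _ < ε ^ 2 := by linarith
  exact (isCompactOperator_iff_isCompact_closure_image_ball (F : E →ₗ[ℂ] E) one_pos).mpr
    (hFb.closure.isCompact_of_isClosed isClosed_closure)

end QuadraticForm

/-! ### The direct sum of `T† T` and `T T†` -/

section DirectSum

variable {H : Type u} [NormedAddCommGroup H] [InnerProductSpace ℂ H]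

lemma isCompactOperator_directSumOp {S R : H →L[ℂ] H} (hS : IsCompactOperator S)
    (hR : IsCompactOperator R) : IsCompactOperator (directSumOp S R) := by
  let e := WithLp.prodContinuousLinearEquiv 2 ℂ H H
  have h1 : IsCompactOperator (((e.symm : H × H →L[ℂ] WithLp 2 (H × H)) ∘L inl ℂ H H) ∘
      S ∘ (fst ℂ H H ∘L (e : WithLp 2 (H × H) →L[ℂ] H × H))) :=
    (hS.comp_clm (fst ℂ H H ∘L (e : WithLp 2 (H × H) →L[ℂ] H × H))).clm_comp
      ((e.symm : H × H →L[ℂ] WithLp 2 (H × H)) ∘L inl ℂ H H)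
  have h2 : IsCompactOperator (((e.symm : H × H →L[ℂ] WithLp 2 (H × H)) ∘L inr ℂ H H) ∘
      R ∘ (snd ℂ H H ∘L (e : WithLp 2 (H × H) →L[ℂ] H × H))) :=
    (hR.comp_clm (snd ℂ H H ∘L (e : WithLp 2 (H × H) →L[ℂ] H × H))).clm_comp
      ((e.symm : H × H →L[ℂ] WithLp 2 (H × H)) ∘L inr ℂ H H)
  have hsum : ⇑(directSumOp S R) =
      (((e.symm : H × H →L[ℂ] WithLp 2 (H × H)) ∘L inl ℂ H H) ∘
        S ∘ (fst ℂ H H ∘L (e : WithLp 2 (H × H) →L[ℂ] H × H))) +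
      (((e.symm : H × H →L[ℂ] WithLp 2 (H × H)) ∘L inr ℂ H H) ∘
        R ∘ (snd ℂ H H ∘L (e : WithLp 2 (H × H) →L[ℂ] H × H))) := by
    funext x
    change e.symm (S x.fst, R x.snd) = e.symm (S x.fst, 0) + e.symm (0, R x.snd)
    rw [← map_add]
    simp
  rw [hsum]
  exact h1.add h2

lemma isPositive_directSumOp {S R : H →L[ℂ] H} (hS : S.IsPositive) (hR : R.IsPositive) :
    (directSumOp S R).IsPositive := by
  refine ⟨fun x y => ?_, fun x => ?_⟩
  · exact congrArg₂ (· + ·) (hS.1 x.fst y.fst) (hR.1 x.snd y.snd)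
  · rw [reApplyInnerSelf_apply]
    change 0 ≤ RCLike.re (inner ℂ (S x.fst) x.fst + inner ℂ (R x.snd) x.snd)
    rw [_root_.map_add]
    exact add_nonneg (hS.2 x.fst) (hR.2 x.snd)

variable [CompleteSpace H]

/-- `(x, y) ↦ (T† x, y)` carries two copies of an eigenspace of `T T†` into that of
`T† T ⊕ T T†`, injectively since `T T†` is injective on the former. -/
lemma rank_eigenspace_add_self_le (T : H →L[ℂ] H) {μ : ℝ} (hμ : μ ≠ 0) :
    Module.rank ℂ (Module.End.eigenspace ((T ∘L adjoint T : H →L[ℂ] H) : H →ₗ[ℂ] H) (μ : ℂ)) +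
      Module.rank ℂ (Module.End.eigenspace ((T ∘L adjoint T : H →L[ℂ] H) : H →ₗ[ℂ] H) (μ : ℂ)) ≤
    Module.rank ℂ (Module.End.eigenspace
      ((directSumOp (adjoint T ∘L T) (T ∘L adjoint T) : WithLp 2 (H × H) →L[ℂ] WithLp 2 (H × H)) :
        WithLp 2 (H × H) →ₗ[ℂ] WithLp 2 (H × H)) (μ : ℂ)) := by
  rw [← rank_prod']
  set E := Module.End.eigenspace ((T ∘L adjoint T : H →L[ℂ] H) : H →ₗ[ℂ] H) (μ : ℂ)
  have hE : ∀ x : E, T (adjoint T x) = (μ : ℂ) • (x : H) := fun x =>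
    Module.End.mem_eigenspace_iff.mp x.2
  refine LinearMap.rank_le_of_injective (LinearMap.codRestrict _
    ((WithLp.linearEquiv 2 ℂ (H × H)).symm.toLinearMap ∘ₗ
      ((adjoint T : H →ₗ[ℂ] H) ∘ₗ E.subtype).prodMap E.subtype) ?_) ?_
  · rintro ⟨x, y⟩
    rw [Module.End.mem_eigenspace_iff]
    change WithLp.toLp 2 (adjoint T (T (adjoint T x)), T (adjoint T y)) =
      WithLp.toLp 2 ((μ : ℂ) • adjoint T (x : H), (μ : ℂ) • (y : H))
    rw [hE, hE, map_smul]
  · rw [injective_iff_map_eq_zero]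
    rintro ⟨x, y⟩ hxy
    have h1 : adjoint T (x : H) = 0 := congrArg (fun z => z.1.fst) hxy
    have h2 : (y : H) = 0 := congrArg (fun z => z.1.snd) hxy
    have h3 := hE x
    rw [h1, map_zero, eq_comm, smul_eq_zero] at h3
    have hx : (x : H) = 0 := h3.resolve_left (by simpa using hμ)
    exact Prod.ext (Subtype.ext hx) (Subtype.ext h2)

/-- If `-T T† ≤ 2 K ≤ T T†` as quadratic forms, then the eigenvalues of `|2 K|` are dominated by
those of two copies of `T T†`. -/
lemma two_mul_singularValue_le {T K : H →L[ℂ] H} (hTc : IsCompactOperator (T ∘L adjoint T))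
    (hK : IsSelfAdjoint K)
    (hle : ∀ x, 2 * |(inner ℂ (K x) x).re| ≤ (inner ℂ ((T ∘L adjoint T) x) x).re)
    {j : ℕ} (hj : 1 ≤ j) :
    2 * singularValue K j ≤
      singularValue (directSumOp (adjoint T ∘L T) (T ∘L adjoint T)) j := by
  set S := directSumOp (adjoint T ∘L T) (T ∘L adjoint T) with hS
  have hSpos : S.IsPositive := isPositive_directSumOp
    (isPositive_adjoint_comp_self T) (isPositive_self_comp_adjoint T)
  have hP : ((T ∘L adjoint T : H →L[ℂ] H) : H →ₗ[ℂ] H).IsSymmetric :=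
    (isPositive_self_comp_adjoint T).1
  obtain ⟨t₀, ht₀, hcount₀⟩ := exists_eigenvalueCount_eq_zero S
  refine le_csInf ⟨t₀, ht₀, ?_⟩ ?_
  · rw [hcount₀]
    exact_mod_cast hj
  rintro t ⟨ht0, ht⟩
  have hmain : Cardinal.sum (fun μ : Set.Ioi t => Module.rank ℂ
        (Module.End.eigenspace ((T ∘L adjoint T : H →L[ℂ] H) : H →ₗ[ℂ] H) ((μ : ℝ) : ℂ))) +
      Cardinal.sum (fun μ : Set.Ioi t => Module.rank ℂ
        (Module.End.eigenspace ((T ∘L adjoint T : H →L[ℂ] H) : H →ₗ[ℂ] H) ((μ : ℝ) : ℂ))) ≤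
      eigenvalueCount S t := by
    rw [← Cardinal.sum_add_distrib', eigenvalueCount_of_isPositive hSpos]
    exact Cardinal.sum_le_sum _ _ fun μ =>
      rank_eigenspace_add_self_le T (ht0.trans_lt μ.2).ne'
  -- A singular value only involves levels with fewer than `j` eigenvalues above them, so the
  -- finiteness required by the comparison is available, also at `t = 0`.
  have hfin := (le_self_add.trans hmain).trans_lt (ht.trans (Cardinal.natCast_lt_aleph0))
  have hKle : ∀ L : H →L[ℂ] H, IsSelfAdjoint L →
      (∀ x, 2 * (inner ℂ (L x) x).re ≤ (inner ℂ ((T ∘L adjoint T) x) x).re) →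
      Cardinal.sum (fun μ : Set.Ioi (t / 2) => Module.rank ℂ
        (Module.End.eigenspace (L : H →ₗ[ℂ] H) ((μ : ℝ) : ℂ))) ≤
      Cardinal.sum (fun μ : Set.Ioi t => Module.rank ℂ
        (Module.End.eigenspace ((T ∘L adjoint T : H →L[ℂ] H) : H →ₗ[ℂ] H) ((μ : ℝ) : ℂ))) :=
    fun L hL hLle => sum_rank_eigenspace_le hL.isSymmetric hP hTc
      (fun x hx => by linarith [hLle x]) hfin
  have hcount : eigenvalueCount K (t / 2) ≤ eigenvalueCount S t := by
    refine le_trans ?_ hmain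
    refine le_trans ?_ (add_le_add
      (hKle K hK fun x => by linarith [hle x, le_abs_self (inner ℂ (K x) x).re])
      (hKle (-K) hK.neg fun x => ?_))
    · rw [← Cardinal.sum_add_distrib', eigenvalueCount]
      refine Cardinal.sum_le_sum _ _ fun μ => rank_eigenspace_abs_le hK ?_
      have : t / 2 < μ := μ.2
      linarith
    · rw [neg_apply, inner_neg_left, Complex.neg_re]
      linarith [hle x, neg_abs_le (inner ℂ (K x) x).re]
  have : singularValue K j ≤ t / 2 :=
    csInf_le ⟨0, fun _ h => h.1⟩ ⟨by linarith, hcount.trans_lt ht⟩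
  linarith

end DirectSum

/-! ### Conjugations and the Cartesian decomposition -/

section Conjugation

variable {H : Type u} [NormedAddCommGroup H] [InnerProductSpace ℂ H]

lemma IsConjugation.map_zero {C : H → H} (hC : IsConjugation C) : C 0 = 0 := by
  simpa using hC.antilinear 1 0 0

lemma IsConjugation.map_add {C : H → H} (hC : IsConjugation C) (x y : H) :
    C (x + y) = C x + C y := by
  simpa using hC.antilinear 1 x y

lemma IsConjugation.map_smul {C : H → H} (hC : IsConjugation C) (α : ℂ) (x : H) :
    C (α • x) = starRingEnd ℂ α • C x := by
  simpa [hC.map_zero] using hC.antilinear α x 0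

variable [CompleteSpace H] {C : H → H} {T A B : H →L[ℂ] H}

lemma IsCNormal.conj_adjoint_comp_self (hC : IsConjugation C) (hT : IsCNormal C T) (x : H) :
    C (adjoint T (T (C x))) = T (adjoint T x) := by
  have h1 (y : H) : CFC.abs T (CFC.abs T y) = adjoint T (T y) :=
    congrArg (fun L : H →L[ℂ] H => L y) (CFC.abs_mul_abs T)
  have h2 (y : H) : CFC.abs (adjoint T) (CFC.abs (adjoint T) y) = T (adjoint T y) := by
    have := congrArg (fun L : H →L[ℂ] H => L y) (CFC.abs_mul_abs (adjoint T))
    simpa [star_eq_adjoint] using this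
  rw [← h1, ← h2, ← hT x, ← hT, hC.involutive]

lemma IsCartesianDecomposition.adjoint_apply (h : IsCartesianDecomposition C T A B) (x : H) :
    adjoint T x = adjoint A x - Complex.I • adjoint B x := by
  rw [h.eq_add, _root_.map_add, LinearIsometryEquiv.map_smulₛₗ]
  simp [sub_eq_add_neg]

/-- With `T' = C T† C = A - i B`, `C`-normality reads `T' T'† = T T†`; the cross terms of the two
sides have opposite signs. -/
lemma IsCartesianDecomposition.comp_adjoint_comm (hC : IsConjugation C) (hT : IsCNormal C T)
    (h : IsCartesianDecomposition C T A B) : B ∘L adjoint A = A ∘L adjoint B := by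
  have hTa (x : H) : T x = A x + Complex.I • B x := by rw [h.eq_add]; rfl
  have hCA (x : H) : C (A x) = adjoint A (C x) := by rw [h.symm, hC.involutive]
  have hCA' (x : H) : C (adjoint A x) = A (C x) := by rw [h.symm, hC.involutive]
  have hCB' (x : H) : C (adjoint B x) = -B (C x) := by rw [← h.skew, hC.involutive]
  have hCB (x : H) : C (B x) = -adjoint B (C x) := by
    have := hCB' (C x)
    rw [hC.involutive] at this
    have h2 := congrArg C this
    rw [hC.involutive, ← neg_one_smul ℂ (B x), hC.map_smul] at h2
    rw [h2]
    simp
  have hCT (x : H) : C (T x) = adjoint A (C x) + Complex.I • adjoint B (C x) := by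
    rw [hTa, hC.map_add, hC.map_smul, hCA, hCB]
    simp
  have hCT' (x : H) : C (adjoint T x) = A (C x) - Complex.I • B (C x) := by
    rw [h.adjoint_apply, sub_eq_add_neg, ← neg_smul, hC.map_add, hC.map_smul, hCA', hCB']
    simp [sub_eq_add_neg]
  ext x
  have key := hT.conj_adjoint_comp_self hC x
  rw [hCT', hCT, hC.involutive, hTa, h.adjoint_apply] at key
  simp only [map_add, map_sub, _root_.map_smul, smul_add, smul_sub, smul_smul,
    Complex.I_mul_I] at key
  have h2 : (2 * Complex.I) • (B (adjoint A x) - A (adjoint B x)) = 0 := by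
    rw [← sub_eq_zero] at key
    rw [← neg_eq_zero, ← key]
    module
  have h3 := (smul_eq_zero.mp h2).resolve_left (by simp)
  exact sub_eq_zero.mp h3

/-- `T T† = A A† + B B†`. -/
lemma IsCartesianDecomposition.re_inner_comp_adjoint (h : IsCartesianDecomposition C T A B)
    (hcomm : B ∘L adjoint A = A ∘L adjoint B) (x : H) :
    (inner ℂ ((T ∘L adjoint T) x) x).re = ‖adjoint A x‖ ^ 2 + ‖adjoint B x‖ ^ 2 := by
  have h1 : (inner ℂ ((T ∘L adjoint T) x) x).re = ‖adjoint T x‖ ^ 2 := by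
    rw [comp_apply, ← adjoint_inner_right, inner_self_eq_norm_sq_to_K]
    norm_cast
  have h2 : (inner ℂ (adjoint A x) (adjoint B x)).im = 0 := by
    have h3 : inner ℂ (adjoint A x) (adjoint B x) = inner ℂ (adjoint B x) (adjoint A x) := by
      rw [adjoint_inner_left, adjoint_inner_left, ← comp_apply, ← comp_apply, hcomm]
    have h4 := inner_conj_symm (𝕜 := ℂ) (adjoint A x) (adjoint B x)
    rw [← h3] at h4
    exact Complex.conj_eq_iff_im.mp h4
  rw [h1, h.adjoint_apply, norm_sub_sq (𝕜 := ℂ), inner_smul_right, norm_smul, Complex.norm_I,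
    one_mul]
  simp [h2]

end Conjugation

theorem mainTheorem12 {H : Type*} [NormedAddCommGroup H] [InnerProductSpace ℂ H]
    [CompleteSpace H] [TopologicalSpace.SeparableSpace H]
    (C : H → H) (hC : IsConjugation C)
    (T : H →L[ℂ] H) (hTc : IsCompactOperator T) (hT : IsCNormal C T)
    (A B : H →L[ℂ] H) (hAB : IsCartesianDecomposition C T A B) :
    IsCompactOperator (B ∘L adjoint A) ∧ IsCompactOperator (A ∘L adjoint B) ∧
    IsCompactOperator (directSumOp (adjoint T ∘L T) (T ∘L adjoint T)) ∧
    ∀ j : ℕ, 1 ≤ j →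
      2 * singularValue (B ∘L adjoint A) j = 2 * singularValue (A ∘L adjoint B) j ∧
      2 * singularValue (A ∘L adjoint B) j ≤
        singularValue (directSumOp (adjoint T ∘L T) (T ∘L adjoint T)) j := by
  have hcomm := hAB.comp_adjoint_comm hC hT
  have hform := hAB.re_inner_comp_adjoint hcomm
  have hTT : IsCompactOperator (T ∘L adjoint T) := hTc.comp_clm (adjoint T)
  have hTT' : IsCompactOperator (adjoint T ∘L T) := hTc.clm_comp (adjoint T)
  have hA : IsCompactOperator (adjoint A) := isCompactOperator_of_norm_sq_le hTT fun x => by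
    have h1 := (Complex.re_le_norm _).trans (norm_inner_le_norm (𝕜 := ℂ) ((T ∘L adjoint T) x) x)
    rw [hform] at h1
    linarith [sq_nonneg ‖adjoint B x‖]
  have hBA : IsCompactOperator (B ∘L adjoint A) := hA.clm_comp B
  have hself : IsSelfAdjoint (A ∘L adjoint B) := by
    rw [isSelfAdjoint_iff', adjoint_comp, adjoint_adjoint, hcomm]
  refine ⟨hBA, hcomm ▸ hBA, isCompactOperator_directSumOp hTT' hTT, fun j hj => ⟨by rw [hcomm], ?_⟩⟩
  refine two_mul_singularValue_le hTT hself (fun x => ?_) hj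
  rw [hform, comp_apply, ← adjoint_inner_right]
  have h1 := (Complex.abs_re_le_norm _).trans
    (norm_inner_le_norm (𝕜 := ℂ) (adjoint B x) (adjoint A x))
  -- `2 |re ⟪B† x, A† x⟫| ≤ ‖A† x‖ ^ 2 + ‖B† x‖ ^ 2`
  nlinarith [sq_nonneg (‖adjoint A x‖ - ‖adjoint B x‖)]
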